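/- Let $A$ be an associative ring with $1$ and with an involution $\alpha\mapsto\overline\alpha$ (additive, $\overline{\alpha\beta}=\overline\beta\,\overline\alpha$, $\overline{\overline\alpha}=\alpha$), let $\lambda\in\operatorname{Cent}(A)$ with $\lambda\overline\lambda=1$, and let $(A,\Lambda)$ be a form ring: $\Lambda$ is an additive subgroup of $A$ with $\{\alpha-\lambda\overline\alpha\mid\alpha\in A\}\subseteq\Lambda\subseteq\{\alpha\in A\mid\alpha=-\lambda\overline\alpha\}$ and $\alpha\Lambda\overline\alpha\subseteq\Lambda$ for all $\alpha\in A$. For a two-sided ideal $I=\overline I$ put $\Gamma_{\max}(I)=I\cap\Lambda$ and $\Gamma_{\min}(I)=\{\xi-\lambda\overline\xi\mid\xi\in I\}+\langle\xi\alpha\overline\xi\mid\xi\in I,\alpha\in\Lambda\rangle$. A form ideal $(I,\Gamma)$ consists of such an $I$ and an additive subgroup $\Gamma$ with $\Gamma_{\min}(I)\subseteq\Gamma\subseteq\Gamma_{\max}(I)$ and $\alpha\Gamma\overline\alpha\subseteq\Gamma$ for all $\alpha\in A$. Put ${}^J\Gamma=\langle\xi\gamma\overline\xi\mid\xi\in J,\gamma\in\Gamma\rangle$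 (additive subgroup generated). Index the rows and columns of $2n\times 2n$ matrices by $\Omega=\{1,\dots,n,-n,\dots,-1\}$, and let $\varepsilon(i)=\pm1$ be the sign of $i\in\Omega$. On the module of columns $A^{2n}$ put $f(u,v)=\overline u_1v_{-1}+\dots+\overline u_nv_{-n}$, $h(u,v)=f(u,v)+\lambda\overline{f(v,u)}$ and $q(u)=f(u,u)\bmod\Lambda\in A/\Lambda$. Let $\operatorname{GU}(2n,A,\Lambda)$ be the group of all $g\in\operatorname{GL}(2n,A)$ preserving $h$ and $q$. Let $\operatorname{GU}(2n,I,\Gamma)$ be the subgroup of those $g\in\operatorname{GU}(2n,A,\Lambda)$ with $g\equiv e$ modulo $I$ and $f(gu,gu)\in f(u,u)+\Gamma$ for all $u$, and let $\operatorname{CU}(2n,I,\Gamma)=\{g\in\operatorname{GU}(2n,A,\Lambda)\mid[g,\operatorname{GU}(2n,A,\Lambda)]\subseteq\operatorname{GU}(2n,I,\Gamma)\}$. Let $T_{ij}(\xi)=e+\xi e_{ij}-\lambda^{(\varepsilon(j)-\varepsilon(i))/2}\,\overline\xi\, e_{-j,-i}$ for $i\ne\pm j$, and $T_{i,-i}(\alpha)=e+\alpha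 e_{i,-i}$. Let $\operatorname{FU}(2n,I,\Gamma)$ be the subgroup generated by all $T_{ij}(\xi)$ with $i\neq\pm j$, $\xi\in I$, and all $T_{i,-i}(\alpha)$ with $\alpha\in\lambda^{-(\varepsilon(i)+1)/2}\Gamma$. Let $\operatorname{EU}(2n,A,\Lambda)=\operatorname{FU}(2n,A,\Lambda)$, and let $\operatorname{EU}(2n,I,\Gamma)$ be the normal closure of $\operatorname{FU}(2n,I,\Gamma)$ in $\operatorname{EU}(2n,A,\Lambda)$. Theorem. Let $n\ge3$, and suppose that the absolute standard commutator formulae $$\operatorname{EU}(2n,I,\Gamma)=[\operatorname{GU}(2n,A,\Lambda),\operatorname{EU}(2n,I,\Gamma)],\qquad \operatorname{EU}(2n,I,\Gamma)=[\operatorname{EU}(2n,A,\Lambda),\operatorname{CU}(2n,I,\Gamma)]$$ hold for every form ideal $(I,\Gamma)$ of $(A,\Lambda)$. Then for any two comaximal form ideals $(I,\Gamma)$ and $(J,\Delta)$ of $(A,\Lambda)$, that is, $I+J=A$, one has $$[\operatorname{EU}(2n,I,\Gamma),\operatorname{EU}(2n,J,\Delta)]=\operatorname{EU}\big(2n,\;IJ+JI,\;{}^J\Gamma+{}^I\Delta+\Gamma_{\min}(IJ+JI)\big).$$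 -/

import Mathlib

open scoped Matrix commutatorElement

namespace BakUnitary

section FormRings

variable {A : Type*} [Ring A] [StarRing A]

/-- `Λ_min = {α - λ ᾱ | α ∈ A}` (the closure is of a set which already is a subgroup). -/
def lambdaMin (lam : A) : AddSubgroup A :=
  AddSubgroup.closure {x | ∃ α : A, x = α - lam * star α}

/-- A form ring structure on a ring `A` with involution `star`: a central symmetry `λ` with
`λ λ̄ = 1` together with a form parameter `Λ`. -/
structure FormRing (A : Type*) [Ring A] [StarRing A] where
  /-- the symmetry `λ` -/
  lam : A
  /-- the form parameter `Λ` -/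
  param : AddSubgroup A
  lam_central : lam ∈ Set.center A
  lam_mul_star : lam * star lam = 1
  min_le : lambdaMin lam ≤ param
  le_max : ∀ α ∈ param, α = -(lam * star α)
  conj_mem : ∀ α : A, ∀ x ∈ param, α * x * star α ∈ param

namespace FormRing

variable (F : FormRing A)

theorem lam_comm (x : A) : F.lam * x = x * F.lam :=
  (Set.mem_center_iff.1 F.lam_central).comm x

theorem star_mul_lam : star F.lam * F.lam = 1 := by
  rw [← F.lam_comm, F.lam_mul_star]

/-- The symmetry `λ` as a unit of `A`; its inverse is `λ̄`. -/
def lamUnit : Aˣ := ⟨F.lam, star F.lam, F.lam_mul_star, F.star_mul_lam⟩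

/-- `Γ_max(I) = I ∩ Λ`. -/
def gammaMax (I : Ideal A) : AddSubgroup A := I.toAddSubgroup ⊓ F.param

/-- `Γ_min(I) = {ξ - λ ξ̄ | ξ ∈ I} + ⟨ξ α ξ̄ | ξ ∈ I, α ∈ Λ⟩`. -/
def gammaMin (I : Ideal A) : AddSubgroup A :=
  AddSubgroup.closure {x | ∃ ξ ∈ I, x = ξ - F.lam * star ξ} ⊔
    AddSubgroup.closure {x | ∃ ξ ∈ I, ∃ α ∈ F.param, x = ξ * α * star ξ}

end FormRing

/-- `^J Γ`, the additive subgroup generated by all `ξ γ ξ̄` with `ξ ∈ J` and `γ ∈ Γ`. -/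
def conjParam (J : Ideal A) (Γ : AddSubgroup A) : AddSubgroup A :=
  AddSubgroup.closure {x | ∃ ξ ∈ J, ∃ γ ∈ Γ, x = ξ * γ * star ξ}

/-- A form ideal `(I, Γ)` of a form ring: an involution-invariant two-sided ideal `I` together
with a relative form parameter `Γ` of level `I`. -/
structure FormIdeal (F : FormRing A) where
  /-- the ideal `I` -/
  ideal : Ideal A
  /-- the relative form parameter `Γ` -/
  param : AddSubgroup A
  twoSided : ideal.IsTwoSided
  star_mem : ∀ x ∈ ideal, star x ∈ ideal
  min_le : F.gammaMin ideal ≤ param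
  le_max : param ≤ F.gammaMax ideal
  conj_mem : ∀ α : A, ∀ x ∈ param, α * x * star α ∈ param

attribute [instance] FormIdeal.twoSided

variable {F : FormRing A}

theorem conjParam_conj_mem (J : Ideal A) (Γ : AddSubgroup A) (α x : A)
    (hx : x ∈ conjParam J Γ) : α * x * star α ∈ conjParam J Γ := by
  induction hx using AddSubgroup.closure_induction with
  | mem x hx =>
    obtain ⟨ξ, hξ, γ, hγ, rfl⟩ := hx
    exact AddSubgroup.subset_closure
      ⟨α * ξ, J.mul_mem_left α hξ, γ, hγ, by simp only [star_mul, mul_assoc]⟩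
  | zero => simp
  | add x y _ _ hx hy => simpa only [mul_add, add_mul] using add_mem hx hy
  | neg x _ hx => simpa only [mul_neg, neg_mul] using neg_mem hx

theorem gammaMin_conj_mem (F : FormRing A) (I : Ideal A) [I.IsTwoSided] (α x : A)
    (hx : x ∈ F.gammaMin I) : α * x * star α ∈ F.gammaMin I := by
  obtain ⟨y, hy, z, hz, rfl⟩ := AddSubgroup.mem_sup.1 hx
  rw [mul_add, add_mul]
  refine add_mem (AddSubgroup.mem_sup_left ?_)
    (AddSubgroup.mem_sup_right (conjParam_conj_mem I F.param α z hz))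
  clear hx
  induction hy using AddSubgroup.closure_induction with
  | mem x hx =>
    obtain ⟨ξ, hξ, rfl⟩ := hx
    refine AddSubgroup.subset_closure
      ⟨α * ξ * star α, I.mul_mem_right _ (I.mul_mem_left α hξ), ?_⟩
    simp only [star_mul, star_star, mul_sub, sub_mul, ← mul_assoc, F.lam_comm α]
  | zero => simp
  | add x y _ _ hx hy => simpa only [mul_add, add_mul] using add_mem hx hy
  | neg x _ hx => simpa only [mul_neg, neg_mul] using neg_mem hx

theorem gammaMin_le_gammaMax (F : FormRing A) (I : Ideal A) [I.IsTwoSided]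
    (hI : ∀ x ∈ I, star x ∈ I) : F.gammaMin I ≤ F.gammaMax I := by
  refine sup_le ((AddSubgroup.closure_le _).2 ?_) ((AddSubgroup.closure_le _).2 ?_)
  · rintro _ ⟨ξ, hξ, rfl⟩
    exact ⟨I.sub_mem hξ (I.mul_mem_left _ (hI ξ hξ)),
      F.min_le (AddSubgroup.subset_closure ⟨ξ, rfl⟩)⟩
  · rintro _ ⟨ξ, hξ, α, hα, rfl⟩
    exact ⟨I.mul_mem_right _ (I.mul_mem_right _ hξ), F.conj_mem ξ α hα⟩

theorem conjParam_le_gammaMax (X : FormIdeal F) (J K : Ideal A) [J.IsTwoSided]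
    (h : J * X.ideal ≤ K) [K.IsTwoSided] : conjParam J X.param ≤ F.gammaMax K := by
  refine (AddSubgroup.closure_le _).2 ?_
  rintro _ ⟨ξ, hξ, γ, hγ, rfl⟩
  exact ⟨K.mul_mem_right _ (h (Ideal.mul_mem_mul hξ (X.le_max hγ).1)),
    F.conj_mem ξ γ (X.le_max hγ).2⟩

theorem sup_isTwoSided (I J : Ideal A) [I.IsTwoSided] [J.IsTwoSided] :
    (I ⊔ J).IsTwoSided := by
  refine ⟨fun {a} b ha => ?_⟩
  obtain ⟨x, hx, y, hy, rfl⟩ := Submodule.mem_sup.1 ha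
  rw [add_mul]
  exact Submodule.add_mem_sup (I.mul_mem_right _ hx) (J.mul_mem_right _ hy)

theorem star_mem_mul (X Y : FormIdeal F) (x : A) (hx : x ∈ X.ideal * Y.ideal) :
    star x ∈ Y.ideal * X.ideal := by
  induction hx using Submodule.mul_induction_on' with
  | mem_mul_mem a ha b hb =>
    rw [star_mul]
    exact Ideal.mul_mem_mul (Y.star_mem b hb) (X.star_mem a ha)
  | add a _ b _ ha hb => rw [star_add]; exact add_mem ha hb

/-- The unit form ideal `(A, Λ)`. -/
def FormIdeal.unit (F : FormRing A) : FormIdeal F where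
  ideal := ⊤
  param := F.param
  twoSided := inferInstance
  star_mem := fun _ _ => trivial
  min_le := (gammaMin_le_gammaMax F ⊤ fun _ _ => trivial).trans inf_le_right
  le_max := fun _ hx => ⟨trivial, hx⟩
  conj_mem := F.conj_mem

/-- The symmetrised product
`(I,Γ)(J,Δ) + (J,Δ)(I,Γ) = (IJ + JI, ^JΓ + ^IΔ + Γ_min(IJ + JI))`. -/
def FormIdeal.symProd (X Y : FormIdeal F) : FormIdeal F where
  ideal := X.ideal * Y.ideal ⊔ Y.ideal * X.ideal
  param := conjParam Y.ideal X.param ⊔ conjParam X.ideal Y.param ⊔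
    F.gammaMin (X.ideal * Y.ideal ⊔ Y.ideal * X.ideal)
  twoSided := sup_isTwoSided _ _
  star_mem := by
    intro x hx
    obtain ⟨a, ha, b, hb, rfl⟩ := Submodule.mem_sup.1 hx
    rw [star_add, add_comm]
    exact Submodule.add_mem_sup (star_mem_mul Y X b hb) (star_mem_mul X Y a ha)
  min_le := le_sup_right
  le_max := by
    have := sup_isTwoSided (X.ideal * Y.ideal) (Y.ideal * X.ideal)
    refine sup_le (sup_le (conjParam_le_gammaMax X _ _ le_sup_right)
      (conjParam_le_gammaMax Y _ _ le_sup_left)) (gammaMin_le_gammaMax F _ ?_)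
    intro x hx
    obtain ⟨a, ha, b, hb, rfl⟩ := Submodule.mem_sup.1 hx
    rw [star_add, add_comm]
    exact Submodule.add_mem_sup (star_mem_mul Y X b hb) (star_mem_mul X Y a ha)
  conj_mem := by
    have := sup_isTwoSided (X.ideal * Y.ideal) (Y.ideal * X.ideal)
    intro α x hx
    obtain ⟨y, hy, z, hz, rfl⟩ := AddSubgroup.mem_sup.1 hx
    obtain ⟨v, hv, w, hw, rfl⟩ := AddSubgroup.mem_sup.1 hy
    simp only [mul_add, add_mul]
    exact add_mem (AddSubgroup.mem_sup_left (add_mem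
      (AddSubgroup.mem_sup_left (conjParam_conj_mem _ _ α v hv))
      (AddSubgroup.mem_sup_right (conjParam_conj_mem _ _ α w hw))))
      (AddSubgroup.mem_sup_right (gammaMin_conj_mem F _ α z hz))

end FormRings

section Groups

/-- The index set `Ω = {1, …, n, -n, …, -1}`: `Sum.inl i` is the positive index with number `i`,
`Sum.inr i` is its negative. -/
abbrev Idx (n : ℕ) : Type := Fin n ⊕ Fin n

/-- `i ↦ -i` on `Ω`. -/
def opp {n : ℕ} (i : Idx n) : Idx n := i.swap

/-- The sign `ε(i) = ±1` of an index. -/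
def sgn {n : ℕ} : Idx n → ℤ
  | Sum.inl _ => 1
  | Sum.inr _ => -1

variable {A : Type*} [Ring A] [StarRing A]

/-- The sesquilinear form `f(u,v) = ū₁ v₋₁ + … + ūₙ v₋ₙ` on columns. -/
def sesq {n : ℕ} (u v : Idx n → A) : A :=
  ∑ i : Fin n, star (u (Sum.inl i)) * v (Sum.inr i)

namespace FormRing

variable (F : FormRing A) {n : ℕ}

/-- The `λ`-hermitian form
`h(u,v) = ū₁ v₋₁ + … + ūₙ v₋ₙ + λ ū₋ₙ vₙ + … + λ ū₋₁ v₁`. -/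
def herm (u v : Idx n → A) : A :=
  ∑ i : Fin n, star (u (Sum.inl i)) * v (Sum.inr i) +
    ∑ i : Fin n, F.lam * star (u (Sum.inr i)) * v (Sum.inl i)

/-- The `Λ`-quadratic form `q(u) = f(u,u) mod Λ`. -/
def quad (u : Idx n → A) : A ⧸ F.param := QuotientAddGroup.mk (sesq u u)

variable (n) in
/-- The hyperbolic unitary group `GU(2n, A, Λ)`. -/
def GU : Subgroup (Matrix.GeneralLinearGroup (Idx n) A) where
  carrier := {g | (∀ u v : Idx n → A, F.herm (g.1 *ᵥ u) (g.1 *ᵥ v) = F.herm u v) ∧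
    ∀ u : Idx n → A, F.quad (g.1 *ᵥ u) = F.quad u}
  one_mem' := by simp
  mul_mem' := by
    rintro g k ⟨hg, hg'⟩ ⟨hk, hk'⟩
    constructor
    · intro u v
      simp only [Units.val_mul, ← Matrix.mulVec_mulVec, hg, hk]
    · intro u
      simp only [Units.val_mul, ← Matrix.mulVec_mulVec, hg', hk']
  inv_mem' := by
    rintro g ⟨hg, hg'⟩
    constructor
    · intro u v
      rw [← hg, Matrix.mulVec_mulVec, Matrix.mulVec_mulVec, Units.mul_inv, Matrix.one_mulVec,
        Matrix.one_mulVec]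
    · intro u
      rw [← hg', Matrix.mulVec_mulVec, Units.mul_inv, Matrix.one_mulVec]

theorem herm_eq (u v : Idx n → A) : F.herm u v = sesq u v + F.lam * star (sesq v u) := by
  simp only [herm, sesq, star_sum, star_mul, star_star, Finset.mul_sum, mul_assoc]

end FormRing

theorem opp_ne {n : ℕ} (i : Idx n) : opp i ≠ i := by
  rcases i with i | i <;> simp [opp]

theorem ne_opp {n : ℕ} (i : Idx n) : i ≠ opp i := (opp_ne i).symm

theorem opp_injective {n : ℕ} : Function.Injective (opp (n := n)) :=
  Function.LeftInverse.injective (g := opp) fun i => Sum.swap_swap i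

/-- `e + N` as an invertible matrix, for `N² = 0`. -/
def unipotent {n : ℕ} (N : Matrix (Idx n) (Idx n) A) (h : N * N = 0) :
    Matrix.GeneralLinearGroup (Idx n) A where
  val := 1 + N
  inv := 1 - N
  val_inv := by simp [mul_sub, add_mul, h]
  inv_val := by simp [mul_add, sub_mul, h]

namespace FormRing

variable (F : FormRing A) {n : ℕ}

/-- The short elementary unitary transvection
`T_{ij}(ξ) = e + ξ e_{ij} - λ^{(ε(j)-ε(i))/2} ξ̄ e_{-j,-i}`, for `i ≠ ±j`. -/
def shortT (i j : Idx n) (hij : i ≠ j) (_hij' : i ≠ opp j) (ξ : A) :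
    Matrix.GeneralLinearGroup (Idx n) A :=
  unipotent (Matrix.single i j ξ -
      Matrix.single (opp j) (opp i) (((F.lamUnit ^ ((sgn j - sgn i) / 2) : Aˣ) : A) * star ξ)) <| by
    have h : opp i ≠ opp j := fun h => hij (opp_injective h)
    simp [sub_mul, mul_sub, hij.symm, h, opp_ne, ne_opp]

end FormRing

/-- The long elementary unitary transvection `T_{i,-i}(α) = e + α e_{i,-i}`. -/
def longT {n : ℕ} (i : Idx n) (α : A) : Matrix.GeneralLinearGroup (Idx n) A :=
  unipotent (Matrix.single i (opp i) α) <| by simp [opp_ne]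

variable {F : FormRing A}

/-- The elementary unitary transvections of level `(I, Γ)`: all `T_{ij}(ξ)` with `i ≠ ±j` and
`ξ ∈ I`, and all `T_{i,-i}(α)` with `α ∈ λ^{-(ε(i)+1)/2} Γ`. -/
inductive IsElementary (n : ℕ) (X : FormIdeal F) : Matrix.GeneralLinearGroup (Idx n) A → Prop
  | short (i j : Idx n) (hij : i ≠ j) (hij' : i ≠ opp j) (ξ : A) (hξ : ξ ∈ X.ideal) :
      IsElementary n X (F.shortT i j hij hij' ξ)
  | long (i : Idx n) (γ : A) (hγ : γ ∈ X.param) :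
      IsElementary n X (longT i (((F.lamUnit ^ (-((sgn i + 1) / 2)) : Aˣ) : A) * γ))

/-- The group `FU(2n, I, Γ)` generated by elementary unitary transvections of level `(I, Γ)`. -/
def FU (n : ℕ) (X : FormIdeal F) : Subgroup (Matrix.GeneralLinearGroup (Idx n) A) :=
  Subgroup.closure {g | IsElementary n X g}

/-- The (absolute) elementary unitary group `EU(2n, A, Λ)`. -/
def FormRing.absEU (F : FormRing A) (n : ℕ) : Subgroup (Matrix.GeneralLinearGroup (Idx n) A) :=
  FU n (FormIdeal.unit F)

/-- The relative elementary subgroup `EU(2n, I, Γ)`: the normal closure of `FU(2n, I, Γ)` in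
`EU(2n, A, Λ)`, that is, the subgroup generated by all `g x g⁻¹` with `g ∈ EU(2n, A, Λ)` and
`x ∈ FU(2n, I, Γ)`. -/
def EU (n : ℕ) (X : FormIdeal F) : Subgroup (Matrix.GeneralLinearGroup (Idx n) A) :=
  Subgroup.closure {z | ∃ g ∈ F.absEU n, ∃ x ∈ FU n X, z = g * x * g⁻¹}

/-- The matrix `g` is congruent to the identity matrix modulo `I`. -/
def CongrOne {n : ℕ} (I : Ideal A) (g : Matrix (Idx n) (Idx n) A) : Prop :=
  ∀ i j, (g - 1) i j ∈ I

theorem mul_entries_mem {n : ℕ} (I : Ideal A) [I.IsTwoSided] (a b c : Matrix (Idx n) (Idx n) A)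
    (hb : ∀ i j, b i j ∈ I) (i j : Idx n) : (a * b * c) i j ∈ I := by
  rw [Matrix.mul_apply]
  refine I.sum_mem fun k _ => I.mul_mem_right _ ?_
  rw [Matrix.mul_apply]
  exact I.sum_mem fun l _ => I.mul_mem_left _ (hb l k)

/-- The principal congruence subgroup `GU(2n, I, Γ)`: those `g ∈ GU(2n, A, Λ)` which are
congruent to `e` modulo `I` and satisfy `f(gu, gu) ∈ f(u, u) + Γ` for all columns `u`. -/
def relGU (n : ℕ) (X : FormIdeal F) : Subgroup (Matrix.GeneralLinearGroup (Idx n) A) where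
  carrier := {g | g ∈ F.GU n ∧ CongrOne X.ideal g.1 ∧
    ∀ u : Idx n → A, sesq (g.1 *ᵥ u) (g.1 *ᵥ u) - sesq u u ∈ X.param}
  one_mem' := ⟨one_mem _, fun i j => by simp, fun u => by simp⟩
  mul_mem' := by
    rintro g k ⟨hg, hg1, hg2⟩ ⟨hk, hk1, hk2⟩
    refine ⟨mul_mem hg hk, fun i j => ?_, fun u => ?_⟩
    · have h : (g * k).1 - 1 = 1 * (g.1 - 1) * k.1 + 1 * (k.1 - 1) * 1 := by
        rw [Units.val_mul]; noncomm_ring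
      rw [h, Matrix.add_apply]
      exact add_mem (mul_entries_mem _ _ _ _ hg1 i j) (mul_entries_mem _ _ _ _ hk1 i j)
    · have h := add_mem (hg2 (k.1 *ᵥ u)) (hk2 u)
      rwa [sub_add_sub_cancel, Matrix.mulVec_mulVec, ← Units.val_mul] at h
  inv_mem' := by
    rintro g ⟨hg, hg1, hg2⟩
    refine ⟨inv_mem hg, fun i j => ?_, fun u => ?_⟩
    · have h : g⁻¹.1 - 1 = -(g⁻¹.1 * (g.1 - 1) * 1) := by
        rw [mul_sub, Units.inv_mul]; noncomm_ring
      rw [h, Matrix.neg_apply]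
      exact neg_mem (mul_entries_mem _ _ _ _ hg1 i j)
    · have h := neg_mem (hg2 (g⁻¹.1 *ᵥ u))
      rwa [Matrix.mulVec_mulVec, Units.mul_inv, Matrix.one_mulVec, neg_sub] at h

/-! The next facts show that `GU(2n, I, Γ)` is normal in `GU(2n, A, Λ)`; this is what makes the
full congruence subgroup a subgroup. -/

theorem sesq_add_left {n : ℕ} (u u' v : Idx n → A) : sesq (u + u') v = sesq u v + sesq u' v := by
  simp [sesq, add_mul, Finset.sum_add_distrib]

theorem sesq_add_right {n : ℕ} (u v v' : Idx n → A) : sesq u (v + v') = sesq u v + sesq u v' := by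
  simp [sesq, mul_add, Finset.sum_add_distrib]

theorem sesq_zero {n : ℕ} (v : Idx n → A) : sesq 0 v = 0 := by
  simp [sesq]

theorem sesq_mul {n : ℕ} (u v : Idx n → A) (a b : A) :
    sesq (fun i => u i * a) (fun i => v i * b) = star a * sesq u v * b := by
  simp [sesq, Finset.mul_sum, Finset.sum_mul, mul_assoc]

theorem sesq_mem {n : ℕ} (I : Ideal A) (u v : Idx n → A)
    (h : ∀ i, v i ∈ I) : sesq u v ∈ I :=
  I.sum_mem fun _ _ => I.mul_mem_left _ (h _)

theorem mulVec_mem {n : ℕ} (I : Ideal A) (g : Matrix (Idx n) (Idx n) A) (v : Idx n → A)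
    (h : ∀ i, v i ∈ I) (i : Idx n) : (g *ᵥ v) i ∈ I := by
  rw [Matrix.mulVec, dotProduct]
  exact I.sum_mem fun _ _ => I.mul_mem_left _ (h _)

/-- `f(gu, gv) - f(u, v)`. -/
def defect {n : ℕ} (g : Matrix.GeneralLinearGroup (Idx n) A) (u v : Idx n → A) : A :=
  sesq (g.1 *ᵥ u) (g.1 *ᵥ v) - sesq u v

theorem defect_add {n : ℕ} (X : FormIdeal F) (g : Matrix.GeneralLinearGroup (Idx n) A)
    (hg : g ∈ F.GU n) (v w : Idx n → A) (hw : ∀ i, w i ∈ X.ideal) :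
    defect g (v + w) (v + w) - defect g v v - defect g w w ∈ X.param := by
  have h : defect g w v = -(F.lam * star (defect g v w)) := by
    have := hg.1 w v
    rw [F.herm_eq, F.herm_eq] at this
    rw [defect, defect, star_sub, mul_sub]
    rw [neg_sub, sub_eq_sub_iff_add_eq_add, this, add_comm]
  have h' : defect g (v + w) (v + w) - defect g v v - defect g w w =
      defect g v w - F.lam * star (defect g v w) := by
    rw [sub_eq_add_neg (defect g v w), ← h]
    simp only [defect, Matrix.mulVec_add, sesq_add_left, sesq_add_right]
    abel
  rw [h']
  refine X.min_le (AddSubgroup.mem_sup_left (AddSubgroup.subset_closure ⟨_, ?_, rfl⟩))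
  exact sub_mem (sesq_mem _ _ _ (mulVec_mem _ _ _ hw)) (sesq_mem _ _ _ hw)

theorem defect_mul {n : ℕ} (X : FormIdeal F) (g : Matrix.GeneralLinearGroup (Idx n) A)
    (hg : g ∈ F.GU n) (v : Idx n → A) (a : A) (ha : a ∈ X.ideal) :
    defect g (fun i => v i * a) (fun i => v i * a) ∈ X.param := by
  have h : defect g (fun i => v i * a) (fun i => v i * a) =
      star a * defect g v v * star (star a) := by
    have h1 : g.1 *ᵥ (fun i => v i * a) = fun i => (g.1 *ᵥ v) i * a := by
      ext i
      simp only [Matrix.mulVec, dotProduct, Finset.sum_mul, mul_assoc]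
    rw [defect, h1, sesq_mul, sesq_mul, star_star, defect, mul_sub, sub_mul]
  rw [h]
  refine X.min_le (AddSubgroup.mem_sup_right (AddSubgroup.subset_closure
    ⟨_, X.star_mem a ha, _, ?_, rfl⟩))
  have h2 := hg.2 v
  rw [FormRing.quad, FormRing.quad, eq_comm, QuotientAddGroup.eq] at h2
  rw [defect, sub_eq_neg_add]
  exact h2

theorem defect_mem {n : ℕ} (X : FormIdeal F) (g : Matrix.GeneralLinearGroup (Idx n) A)
    (hg : g ∈ F.GU n) (w : Idx n → A) (hw : ∀ i, w i ∈ X.ideal) :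
    defect g w w ∈ X.param := by
  have key : ∀ s : Finset (Idx n),
      defect g (∑ k ∈ s, fun i => (Pi.single k (1 : A) : Idx n → A) i * w k)
        (∑ k ∈ s, fun i => (Pi.single k (1 : A) : Idx n → A) i * w k) ∈ X.param := by
    intro s
    induction s using Finset.induction_on with
    | empty => simp [defect, sesq_zero]
    | insert a s ha ih =>
      rw [Finset.sum_insert ha]
      have h := defect_add X g hg (fun i => (Pi.single a (1 : A) : Idx n → A) i * w a)
        (∑ k ∈ s, fun i => (Pi.single k (1 : A) : Idx n → A) i * w k) (fun i => by
          rw [Finset.sum_apply]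
          exact Ideal.sum_mem _ fun k _ => Ideal.mul_mem_left _ _ (hw k))
      have h2 := defect_mul X g hg (Pi.single a 1) (w a) (hw a)
      have := add_mem (add_mem h ih) h2
      rwa [sub_add_cancel, sub_add_cancel] at this
  have hsum : (∑ k : Idx n, fun i => (Pi.single k (1 : A) : Idx n → A) i * w k) = w := by
    ext i
    rw [Finset.sum_apply]
    simp only [Pi.single_apply, ite_mul, one_mul, zero_mul, Finset.sum_ite_eq, Finset.mem_univ,
      if_true]
  have := key Finset.univ
  rwa [hsum] at this

theorem relGU_conj_mem {n : ℕ} (X : FormIdeal F) (g x : Matrix.GeneralLinearGroup (Idx n) A)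
    (hg : g ∈ F.GU n) (hx : x ∈ relGU n X) : g * x * g⁻¹ ∈ relGU n X := by
  obtain ⟨hx0, hx1, hx2⟩ := hx
  refine ⟨mul_mem (mul_mem hg hx0) (inv_mem hg), fun i j => ?_, fun u => ?_⟩
  · have h : (g * x * g⁻¹).1 - 1 = g.1 * (x.1 - 1) * g⁻¹.1 := by
      rw [mul_sub, sub_mul, mul_one, Units.mul_inv, Units.val_mul, Units.val_mul]
    rw [h]
    exact mul_entries_mem _ _ _ _ hx1 i j
  · obtain ⟨v, rfl⟩ : ∃ v, u = g.1 *ᵥ v :=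
      ⟨g⁻¹.1 *ᵥ u, by rw [Matrix.mulVec_mulVec, Units.mul_inv, Matrix.one_mulVec]⟩
    have hgx : (g * x * g⁻¹).1 *ᵥ (g.1 *ᵥ v) = g.1 *ᵥ (x.1 *ᵥ v) := by
      rw [Matrix.mulVec_mulVec, Matrix.mulVec_mulVec, ← Units.val_mul, ← Units.val_mul,
        inv_mul_cancel_right]
    have hw : ∀ i, ((x.1 - 1) *ᵥ v) i ∈ X.ideal := fun i => by
      rw [Matrix.mulVec, dotProduct]
      exact Ideal.sum_mem _ fun k _ => Ideal.mul_mem_right _ _ (hx1 i k)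
    have hxv : x.1 *ᵥ v = v + (x.1 - 1) *ᵥ v := by
      rw [Matrix.sub_mulVec, Matrix.one_mulVec]; abel
    have h1 := defect_add X g hg v _ hw
    have h2 := defect_mem X g hg _ hw
    rw [← hxv] at h1
    have h3 := add_mem (add_mem h1 h2) (hx2 v)
    rw [hgx]
    convert h3 using 1
    simp only [defect]
    abel

/-- The full congruence subgroup
`CU(2n, I, Γ) = {g ∈ GU(2n, A, Λ) | [g, GU(2n, A, Λ)] ⊆ GU(2n, I, Γ)}`. -/
def CU (n : ℕ) (X : FormIdeal F) : Subgroup (Matrix.GeneralLinearGroup (Idx n) A) where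
  carrier := {g | g ∈ F.GU n ∧ ∀ x ∈ F.GU n, ⁅g, x⁆ ∈ relGU n X}
  one_mem' := ⟨one_mem _, fun x _ => by simp [commutatorElement_def]⟩
  mul_mem' := by
    rintro g k ⟨hg, hg'⟩ ⟨hk, hk'⟩
    refine ⟨mul_mem hg hk, fun x hx => ?_⟩
    have h : ⁅g * k, x⁆ = g * ⁅k, x⁆ * g⁻¹ * ⁅g, x⁆ := by
      simp only [commutatorElement_def]; group
    rw [h]
    exact mul_mem (relGU_conj_mem X g _ hg (hk' x hx)) (hg' x hx)
  inv_mem' := by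
    rintro g ⟨hg, hg'⟩
    refine ⟨inv_mem hg, fun x hx => ?_⟩
    have h : ⁅g⁻¹, x⁆ = g⁻¹ * ⁅g, x⁆⁻¹ * g⁻¹⁻¹ := by
      simp only [commutatorElement_def]; group
    rw [h]
    exact relGU_conj_mem X _ _ (inv_mem hg) (inv_mem (hg' x hx))

/-- The absolute standard commutator formulae in degree `2n`: for every form ideal `(I, Γ)`,
`EU(2n, I, Γ) = [GU(2n, A, Λ), EU(2n, I, Γ)]` and `EU(2n, I, Γ) = [EU(2n, A, Λ), CU(2n, I, Γ)]`. -/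
def FormRing.AbsoluteStandardCommutatorFormulae (F : FormRing A) (n : ℕ) : Prop :=
  ∀ X : FormIdeal F, EU n X = ⁅F.GU n, EU n X⁆ ∧ EU n X = ⁅F.absEU n, CU n X⁆

end Groups

end BakUnitary

/-! Write `M`, `N` for the elementary groups of the two form ideals, `H` for the absolute elementary
group and `L` for the elementary group of the symmetrised product; all are normal in `H`.

The inclusion `L ≤ ⁅M, N⁆` (`EU_symProd_le`) comes from the Steinberg-type relations: commutators of
transvections of levels `X` and `Y` produce every generator of level `X.symProd Y`, and `n ≥ 3`
supplies the auxiliary index these relations need.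

For the reverse inclusion, a congruence computation (`commutator_relGU_le`) puts `⁅M, N⁆` inside the
full congruence subgroup of level `X.symProd Y`. The standard formula `EU = ⁅absEU, CU⁆` at that
level then gives `⁅H, ⁅M, N⁆⁆ ≤ L`: modulo `L`, the group `⁅M, N⁆` is central in `H`. Comaximality
gives `H = M N` (`EU_sup_EU`), and `M ≤ ⁅H, M⁆`, so modulo `L` the group `M` lies in `⁅M, M⁆ ⁅M,
N⁆`. The factor `⁅M, N⁆` is central, and `⁅M, M⁆` commutes with `N` by the three subgroups lemma.
Hence `M` commutes with `N` modulo `L` (`Subgroup.commutator_le_of_sup_eq`). -/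

/-! ### Group theory: commutators of two normal subgroups that generate the group. -/

/-- If `G = M N` with `M`, `N` normal, `M ≤ [G, M]` and `[M, N]` central, then `[M, N] = 1`. -/
theorem Subgroup.commutator_eq_bot_of_central {G : Type*} [Group G] (M N : Subgroup G)
    [M.Normal] [N.Normal] (hMN : M ⊔ N = ⊤) (hM : M ≤ ⁅(⊤ : Subgroup G), M⁆)
    (hc : ⁅(⊤ : Subgroup G), ⁅M, N⁆⁆ = ⊥) : ⁅M, N⁆ = ⊥ := by
  have hc' : ∀ P : Subgroup G, ⁅P, ⁅M, N⁆⁆ = ⊥ := fun P =>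
    le_bot_iff.1 ((Subgroup.commutator_mono le_top le_rfl).trans hc.le)
  -- Three subgroups lemma: both rotated commutators contain `⁅M, N⁆`, which is central.
  have h1 : ⁅⁅M, M⁆, N⁆ = ⊥ := by
    apply Subgroup.commutator_commutator_eq_bot_of_rotate
    · rw [Subgroup.commutator_comm, hc']
    · rw [Subgroup.commutator_comm, Subgroup.commutator_comm N M, hc']
  have h2 : ⁅⁅M, N⁆, N⁆ = ⊥ := by rw [Subgroup.commutator_comm, hc']
  rw [Subgroup.commutator_eq_bot_iff_le_centralizer] at h1 h2 ⊢
  -- It remains to show `⁅⊤, M⁆ ≤ ⁅M, M⁆ ⊔ ⁅M, N⁆`: split `g = a * b` with `a ∈ M`, `b ∈ N` and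
  -- expand the commutator.
  refine hM.trans (le_trans ?_ (sup_le h1 h2))
  rw [Subgroup.commutator_le]
  intro g _ m hm
  obtain ⟨a, ha, b, hb, rfl⟩ := Subgroup.mem_sup_of_normal_right.1
    (show g ∈ M ⊔ N from hMN ▸ Subgroup.mem_top g)
  have h : ⁅a * b, m⁆ = a * ⁅b, m⁆ * a⁻¹ * ⁅a, m⁆ := by
    simp only [commutatorElement_def]; group
  rw [h, sup_comm]
  refine Subgroup.mul_mem_sup (Subgroup.Normal.conj_mem inferInstance _ ?_ a)
    (Subgroup.commutator_mem_commutator ha hm)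
  rw [Subgroup.commutator_comm]
  exact Subgroup.commutator_mem_commutator hb hm

/-- Pass to `G ⧸ L`, where the third hypothesis says that `⁅M, N⁆` is central. -/
theorem Subgroup.commutator_le_of_normal {G : Type*} [Group G] (M N L : Subgroup G)
    [M.Normal] [N.Normal] [L.Normal] (hMN : M ⊔ N = ⊤) (hM : M ≤ ⁅(⊤ : Subgroup G), M⁆)
    (hc : ⁅(⊤ : Subgroup G), ⁅M, N⁆⁆ ≤ L) : ⁅M, N⁆ ≤ L := by
  have hs := QuotientGroup.mk'_surjective L
  have := Subgroup.Normal.map (H := M) inferInstance _ hs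
  have := Subgroup.Normal.map (H := N) inferInstance _ hs
  have ht : (⊤ : Subgroup G).map (QuotientGroup.mk' L) = ⊤ := Subgroup.map_top_of_surjective _ hs
  have h := Subgroup.commutator_eq_bot_of_central (M.map (QuotientGroup.mk' L))
    (N.map (QuotientGroup.mk' L)) (by rw [← Subgroup.map_sup, hMN, ht])
    (by rw [← ht, ← Subgroup.map_commutator]; exact Subgroup.map_mono hM)
    (by
      rw [← ht, ← Subgroup.map_commutator, ← Subgroup.map_commutator, Subgroup.map_eq_bot_iff,
        QuotientGroup.ker_mk']
      exact hc)
  rwa [← Subgroup.map_commutator, Subgroup.map_eq_bot_iff, QuotientGroup.ker_mk'] at h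

/-- The same for subgroups of a group `G` all normalised by a subgroup `H`. -/
theorem Subgroup.commutator_le_of_sup_eq {G : Type*} [Group G] (H M N L : Subgroup G)
    (hMN : M ⊔ N = H) (hLH : L ≤ H) (hMn : ∀ g ∈ H, ∀ x ∈ M, g * x * g⁻¹ ∈ M)
    (hNn : ∀ g ∈ H, ∀ x ∈ N, g * x * g⁻¹ ∈ N) (hLn : ∀ g ∈ H, ∀ x ∈ L, g * x * g⁻¹ ∈ L)
    (hM : M ≤ ⁅H, M⁆) (hc : ⁅H, ⁅M, N⁆⁆ ≤ L) : ⁅M, N⁆ ≤ L := by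
  have hMH : M ≤ H := hMN ▸ le_sup_left
  have hNH : N ≤ H := hMN ▸ le_sup_right
  have normal : ∀ P : Subgroup G, (∀ g ∈ H, ∀ x ∈ P, g * x * g⁻¹ ∈ P) → (P.subgroupOf H).Normal :=
    fun P hP => ⟨fun x hx g => hP g g.2 x hx⟩
  have := normal M hMn
  have := normal N hNn
  have := normal L hLn
  have map : ∀ P ≤ H, (P.subgroupOf H).map H.subtype = P := fun P hP =>
    Subgroup.map_subgroupOf_eq_of_le hP
  have mapt : (⊤ : Subgroup H).map H.subtype = H := by
    rw [← MonoidHom.range_eq_map, Subgroup.range_subtype]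
  have inj := Subgroup.map_injective H.subtype_injective
  have h := Subgroup.commutator_le_of_normal (M.subgroupOf H) (N.subgroupOf H) (L.subgroupOf H)
    (inj (by rw [Subgroup.map_sup, map M hMH, map N hNH, mapt, hMN]))
    (by
      rw [← Subgroup.map_le_map_iff_of_injective H.subtype_injective, Subgroup.map_commutator,
        map M hMH, mapt]
      exact hM)
    (by
      rw [← Subgroup.map_le_map_iff_of_injective H.subtype_injective, Subgroup.map_commutator,
        Subgroup.map_commutator, map M hMH, map N hNH, map L hLH, mapt]
      exact hc)
  rwa [← Subgroup.map_le_map_iff_of_injective H.subtype_injective, Subgroup.map_commutator,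
        map M hMH, map N hNH, map L hLH] at h

theorem Subgroup.commutator_conj_mem {G : Type*} [Group G] (M N : Subgroup G) (g : G)
    (hM : ∀ x ∈ M, g * x * g⁻¹ ∈ M) (hN : ∀ x ∈ N, g * x * g⁻¹ ∈ N) (x : G) (hx : x ∈ ⁅M, N⁆) :
    g * x * g⁻¹ ∈ ⁅M, N⁆ := by
  have h : (⁅M, N⁆).map (MulAut.conj g).toMonoidHom ≤ ⁅M, N⁆ := by
    rw [Subgroup.map_commutator]
    refine Subgroup.commutator_mono ?_ ?_
    · rintro _ ⟨y, hy, rfl⟩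
      exact hM y hy
    · rintro _ ⟨y, hy, rfl⟩
      exact hN y hy
  exact h ⟨x, hx, rfl⟩

/-! ### Monotonicity and normality of the elementary subgroups. -/

namespace BakUnitary

section Groups

variable {A : Type*} [Ring A] [StarRing A] {F : FormRing A} {n : ℕ}

theorem FU_mono {X Y : FormIdeal F} (hi : X.ideal ≤ Y.ideal) (hp : X.param ≤ Y.param) :
    FU n X ≤ FU n Y := by
  refine Subgroup.closure_mono ?_
  rintro _ (⟨i, j, hij, hij', ξ, hξ⟩ | ⟨i, γ, hγ⟩)
  · exact .short i j hij hij' ξ (hi hξ)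
  · exact .long i γ (hp hγ)

theorem EU_mono {X Y : FormIdeal F} (hi : X.ideal ≤ Y.ideal) (hp : X.param ≤ Y.param) :
    EU n X ≤ EU n Y := by
  refine Subgroup.closure_mono ?_
  rintro _ ⟨g, hg, x, hx, rfl⟩
  exact ⟨g, hg, x, FU_mono hi hp hx, rfl⟩

theorem FU_le_absEU (X : FormIdeal F) : FU n X ≤ F.absEU n :=
  FU_mono le_top (X.le_max.trans inf_le_right)

theorem FU_le_EU (X : FormIdeal F) : FU n X ≤ EU n X := fun x hx =>
  Subgroup.subset_closure ⟨1, one_mem _, x, hx, by simp⟩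

theorem EU_le {X : FormIdeal F} {K : Subgroup (Matrix.GeneralLinearGroup (Idx n) A)}
    (hX : FU n X ≤ K) (hK : ∀ g ∈ F.absEU n, ∀ x ∈ K, g * x * g⁻¹ ∈ K) : EU n X ≤ K := by
  refine (Subgroup.closure_le _).2 ?_
  rintro _ ⟨g, hg, x, hx, rfl⟩
  exact hK g hg x (hX hx)

theorem EU_le_absEU (X : FormIdeal F) : EU n X ≤ F.absEU n :=
  EU_le (FU_le_absEU X) fun _ hg _ hx => mul_mem (mul_mem hg hx) (inv_mem hg)

theorem EU_conj_mem (X : FormIdeal F) (g : Matrix.GeneralLinearGroup (Idx n) A)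
    (hg : g ∈ F.absEU n) (x : Matrix.GeneralLinearGroup (Idx n) A) (hx : x ∈ EU n X) :
    g * x * g⁻¹ ∈ EU n X := by
  induction hx using Subgroup.closure_induction with
  | mem x hx =>
    obtain ⟨k, hk, y, hy, rfl⟩ := hx
    exact Subgroup.subset_closure ⟨g * k, mul_mem hg hk, y, hy, by group⟩
  | one => simp
  | mul x y _ _ hx hy => rw [← conj_mul]; exact mul_mem hx hy
  | inv x _ hx => rw [← conj_inv]; exact inv_mem hx

theorem EU_unit : EU n (FormIdeal.unit F) = F.absEU n :=
  le_antisymm (EU_le_absEU _) (FU_le_EU _)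

end Groups

end BakUnitary

/-! ### Additivity and commutator relations of transvections. -/

namespace BakUnitary

section Transvections

variable {A : Type*} [Ring A] [StarRing A] (F : FormRing A) {n : ℕ}

theorem opp_opp (i : Idx n) : opp (opp i) = i := Sum.swap_swap i

theorem opp_inj {i j : Idx n} : opp i = opp j ↔ i = j := opp_injective.eq_iff

theorem FormRing.star_lam_comm (x : A) : star F.lam * x = x * star F.lam := by
  rw [← star_star (star F.lam * x), star_mul, star_star, ← F.lam_comm, star_mul, star_star]

/-- `λ^{(ε(j)-ε(i))/2}`. -/
def FormRing.shortCoeff (i j : Idx n) : A := ((F.lamUnit ^ ((sgn j - sgn i) / 2) : Aˣ) : A)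

/-- `λ^{-(ε(i)+1)/2}`. -/
def FormRing.longCoeff (i : Idx n) : A := ((F.lamUnit ^ (-((sgn i + 1) / 2)) : Aˣ) : A)

@[simp] theorem FormRing.shortCoeff_inl_inl (i j : Fin n) :
    F.shortCoeff (.inl i) (.inl j) = 1 := by simp [FormRing.shortCoeff, sgn]

@[simp] theorem FormRing.shortCoeff_inr_inr (i j : Fin n) :
    F.shortCoeff (.inr i) (.inr j) = 1 := by simp [FormRing.shortCoeff, sgn]

@[simp] theorem FormRing.shortCoeff_inl_inr (i j : Fin n) :
    F.shortCoeff (.inl i) (.inr j) = star F.lam := by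
  simp [FormRing.shortCoeff, sgn, FormRing.lamUnit]

@[simp] theorem FormRing.shortCoeff_inr_inl (i j : Fin n) :
    F.shortCoeff (.inr i) (.inl j) = F.lam := by
  simp [FormRing.shortCoeff, sgn, FormRing.lamUnit]

@[simp] theorem FormRing.longCoeff_inl (i : Fin n) : F.longCoeff (.inl i) = star F.lam := by
  simp [FormRing.longCoeff, sgn, FormRing.lamUnit]

@[simp] theorem FormRing.longCoeff_inr (i : Fin n) : F.longCoeff (.inr i : Idx n) = 1 := by
  simp [FormRing.longCoeff, sgn]

theorem FormRing.shortCoeff_comm (i j : Idx n) (x : A) :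
    F.shortCoeff i j * x = x * F.shortCoeff i j := by
  rcases i with i | i <;> rcases j with j | j <;> simp [F.lam_comm, F.star_lam_comm]

theorem FormRing.mul_shortCoeff_mul (i j : Idx n) (x y : A) :
    x * (F.shortCoeff i j * y) = F.shortCoeff i j * (x * y) := by
  rw [← mul_assoc, ← F.shortCoeff_comm, mul_assoc]

/-- The exponents telescope: differences of signs are even, so the integer division loses nothing.
-/
theorem FormRing.shortCoeff_mul (i j k : Idx n) :
    F.shortCoeff i j * F.shortCoeff j k = F.shortCoeff i k := by
  rcases i with i | i <;> rcases j with j | j <;> rcases k with k | k <;>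
    simp [F.lam_mul_star, F.star_mul_lam]

theorem FormRing.shortCoeff_mul_longCoeff (i j : Idx n) :
    F.shortCoeff i j * F.longCoeff j = F.longCoeff i := by
  rcases i with i | i <;> rcases j with j | j <;>
    simp [F.lam_mul_star]

theorem single_neg_eq (i j : Idx n) (a : A) : Matrix.single i j (-a) = -Matrix.single i j a :=
  (Matrix.singleAddMonoidHom i j).map_neg a

theorem single_sub (i j : Idx n) (a b : A) :
    Matrix.single i j (a - b) = Matrix.single i j a - Matrix.single i j b :=
  (Matrix.singleAddMonoidHom i j).map_sub a b

theorem FormRing.shortT_val (i j : Idx n) (hij : i ≠ j) (hij' : i ≠ opp j) (ξ : A) :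
    (F.shortT i j hij hij' ξ).1 = 1 + (Matrix.single i j ξ -
      Matrix.single (opp j) (opp i) (F.shortCoeff i j * star ξ)) := rfl

theorem longT_val (i : Idx n) (α : A) : (longT i α).1 = 1 + Matrix.single i (opp i) α := rfl

theorem FormRing.shortT_add (i j : Idx n) (hij : i ≠ j) (hij' : i ≠ opp j) (ξ ζ : A) :
    F.shortT i j hij hij' (ξ + ζ) = F.shortT i j hij hij' ξ * F.shortT i j hij hij' ζ := by
  have h : opp i ≠ opp j := fun h => hij (opp_injective h)
  apply Units.ext
  simp only [Units.val_mul, FormRing.shortT_val, star_add, mul_add, Matrix.single_add, add_mul,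
    sub_mul, mul_sub]
  simp [hij.symm, h, opp_ne, ne_opp]
  abel

theorem FormRing.shortT_zero (i j : Idx n) (hij : i ≠ j) (hij' : i ≠ opp j) :
    F.shortT i j hij hij' 0 = 1 := by
  apply Units.ext
  simp [FormRing.shortT_val]

theorem FormRing.shortT_neg (i j : Idx n) (hij : i ≠ j) (hij' : i ≠ opp j) (ξ : A) :
    F.shortT i j hij hij' (-ξ) = (F.shortT i j hij hij' ξ)⁻¹ := by
  rw [eq_inv_iff_mul_eq_one, ← F.shortT_add, neg_add_cancel, F.shortT_zero]

theorem longT_add (i : Idx n) (α β : A) : longT i (α + β) = longT i α * longT i β := by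
  apply Units.ext
  simp only [Units.val_mul, longT_val, Matrix.single_add, add_mul, mul_add]
  simp [opp_ne]
  abel

theorem longT_zero (i : Idx n) : longT i (0 : A) = 1 := by
  apply Units.ext
  simp [longT_val]

theorem longT_neg (i : Idx n) (α : A) : longT i (-α) = (longT i α)⁻¹ := by
  rw [eq_inv_iff_mul_eq_one, ← longT_add, neg_add_cancel, longT_zero]

theorem FormRing.commutator_shortT_shortT (i j k : Idx n) (hij : i ≠ j) (hij' : i ≠ opp j)
    (hjk : j ≠ k) (hjk' : j ≠ opp k) (hik : i ≠ k) (hik' : i ≠ opp k) (ξ ζ : A) :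
    ⁅F.shortT i j hij hij' ξ, F.shortT j k hjk hjk' ζ⁆ = F.shortT i k hik hik' (ξ * ζ) := by
  have hji' : j ≠ opp i := fun h => hij' (by rw [h, opp_opp])
  have hkj' : k ≠ opp j := fun h => hjk' (by rw [h, opp_opp])
  -- Clearing inverses turns `⁅x, y⁆ = z` into `x * y = z * y * x`, which is checked on matrix
  -- units.
  rw [commutatorElement_def, mul_inv_eq_iff_eq_mul, mul_inv_eq_iff_eq_mul]
  apply Units.ext
  have hc : F.shortCoeff i k * (star ζ * star ξ) =
      F.shortCoeff j k * star ζ * (F.shortCoeff i j * star ξ) := by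
    rw [← F.shortCoeff_mul i j k]
    simp only [mul_assoc, F.mul_shortCoeff_mul i j]
  simp only [Units.val_mul, FormRing.shortT_val, star_mul, hc, add_mul, sub_mul, mul_sub, mul_add,
    one_mul, mul_one]
  simp [hij, hij'.symm, hjk.symm, hjk', hik, hik.symm, hkj', hji'.symm, opp_inj, opp_ne, ne_opp]
  abel

/-- The case `k = -i` of the preceding relation: the positions `(i, k)` and `(-k, -i)` coincide, so
the two entries add up to one long parameter. -/
theorem FormRing.commutator_shortT_shortT_opp (i j : Idx n) (hij : i ≠ j) (hij' : i ≠ opp j)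
    (hji : j ≠ opp i) (hji' : j ≠ opp (opp i)) (ξ ζ : A) :
    ⁅F.shortT i j hij hij' ξ, F.shortT j (opp i) hji hji' ζ⁆ =
      longT i (ξ * ζ - F.shortCoeff i (opp i) * star (ξ * ζ)) := by
  rw [commutatorElement_def, mul_inv_eq_iff_eq_mul, mul_inv_eq_iff_eq_mul]
  apply Units.ext
  have hc : F.shortCoeff i (opp i) * (star ζ * star ξ) =
      F.shortCoeff j (opp i) * star ζ * (F.shortCoeff i j * star ξ) := by
    rw [← F.shortCoeff_mul i j (opp i)]
    simp only [mul_assoc, F.mul_shortCoeff_mul i j]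
  simp only [Units.val_mul, FormRing.shortT_val, longT_val, star_mul, hc, add_mul, sub_mul,
    mul_sub, mul_add, one_mul, mul_one, single_sub, opp_opp]
  simp [hij, hij.symm, hij'.symm, hji.symm, opp_inj, opp_ne]
  abel

/-- The condition `γ = -λ γ̄`, transported to the rescaled parameters of long transvections. -/
theorem FormRing.longCoeff_mul_eq_neg (j : Idx n) {γ : A} (hγ : γ ∈ F.param) :
    F.longCoeff j * γ = -(F.shortCoeff j (opp j) * star (F.longCoeff j * γ)) := by
  have h := F.le_max γ hγ
  rcases j with j | j
  · simp only [opp, Sum.swap_inl, FormRing.longCoeff_inl, FormRing.shortCoeff_inl_inr, star_mul,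
      star_star, ← F.lam_comm]
    rw [← mul_neg, ← h]
  · simpa [opp] using h

theorem FormRing.commutator_shortT_longT (i j : Idx n) (hij : i ≠ j) (hij' : i ≠ opp j)
    (hij'' : i ≠ opp (opp j)) (ξ : A) {γ : A} (hγ : γ ∈ F.param) :
    ⁅F.shortT i j hij hij' ξ, longT j (F.longCoeff j * γ)⁆ =
      F.shortT i (opp j) hij' hij'' (ξ * (F.longCoeff j * γ)) *
        longT i (F.longCoeff i * (ξ * γ * star ξ)) := by
  have hji' : j ≠ opp i := fun h => hij' (by rw [h, opp_opp])
  rw [commutatorElement_def, mul_inv_eq_iff_eq_mul, mul_inv_eq_iff_eq_mul]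
  apply Units.ext
  have hα := F.longCoeff_mul_eq_neg j hγ
  have h1 : F.longCoeff i * (ξ * γ * star ξ) =
      ξ * ((F.longCoeff j * γ) * (F.shortCoeff i j * star ξ)) := by
    rw [← F.shortCoeff_mul_longCoeff i j, F.mul_shortCoeff_mul i j, F.mul_shortCoeff_mul i j]
    have : F.longCoeff j * (ξ * γ * star ξ) = ξ * (F.longCoeff j * γ * star ξ) := by
      rcases j with j | j <;> simp [F.star_lam_comm, mul_assoc]
    rw [mul_assoc, this]
  -- The skew-symmetry `hα` identifies the second entry of the short factor with the one occurring
  -- in the product.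
  have h2 : F.shortCoeff i (opp j) * star (ξ * (F.longCoeff j * γ)) =
      -((F.longCoeff j * γ) * (F.shortCoeff i j * star ξ)) := by
    rw [star_mul, ← F.shortCoeff_mul i j (opp j)]
    conv_rhs => rw [hα]
    rw [neg_mul, neg_neg]
    simp only [mul_assoc, F.mul_shortCoeff_mul i j]
  generalize F.longCoeff j * γ = α at *
  simp only [Units.val_mul, FormRing.shortT_val, longT_val, h1, h2, add_mul, sub_mul,
    mul_sub, mul_add, one_mul, mul_one, single_neg_eq, opp_opp, sub_neg_eq_add]
  simp [hij, hij'.symm, hji'.symm, opp_inj, opp_ne, mul_assoc]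
  abel

end Transvections

end BakUnitary

/-! ### Congruence subgroups, controlled through the defect `f(gu, gv) - f(u, v)`. -/

namespace BakUnitary

section Defect

variable {A : Type*} [Ring A] [StarRing A] {F : FormRing A} {n : ℕ}

@[simp] theorem sesq_single_inl_left (i : Fin n) (a : A) (v : Idx n → A) :
    sesq (Pi.single (.inl i) a) v = star a * v (.inr i) := by
  rw [sesq, Finset.sum_eq_single i] <;> simp +contextual

@[simp] theorem sesq_single_inr_left (i : Fin n) (a : A) (v : Idx n → A) :
    sesq (Pi.single (.inr i) a) v = 0 := by
  simp [sesq]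

@[simp] theorem sesq_single_inr_right (i : Fin n) (a : A) (u : Idx n → A) :
    sesq u (Pi.single (.inr i) a) = star (u (.inl i)) * a := by
  rw [sesq, Finset.sum_eq_single i] <;> simp +contextual

@[simp] theorem sesq_single_inl_right (i : Fin n) (a : A) (u : Idx n → A) :
    sesq u (Pi.single (.inl i) a) = 0 := by
  simp [sesq]

theorem sesq_neg_left (u v : Idx n → A) : sesq (-u) v = -sesq u v := by simp [sesq]

theorem sesq_neg_right (u v : Idx n → A) : sesq u (-v) = -sesq u v := by simp [sesq]

theorem single_mulVec_eq (i j : Idx n) (a : A) (u : Idx n → A) :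
    Matrix.single i j a *ᵥ u = Pi.single i (a * u j) := by
  ext k
  by_cases h : k = i
  · subst h; simp [Matrix.mulVec, dotProduct, Matrix.single_apply]
  · simp [Matrix.mulVec, dotProduct, h, Ne.symm h]

theorem defect_of_val_eq {g : Matrix.GeneralLinearGroup (Idx n) A} {N : Matrix (Idx n) (Idx n) A}
    (h : g.1 = 1 + N) (u v : Idx n → A) :
    defect g u v = sesq (N *ᵥ u) v + sesq u (N *ᵥ v) + sesq (N *ᵥ u) (N *ᵥ v) := by
  rw [defect, h]
  simp only [Matrix.add_mulVec, Matrix.one_mulVec, sesq_add_left, sesq_add_right]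
  abel

/-- Reduces membership to the defect: `hh` is invariance of `h`, and `hp` also gives invariance of
`q` because relative parameters lie in `Λ`. -/
theorem mem_relGU_of_defect (X : FormIdeal F) {g : Matrix.GeneralLinearGroup (Idx n) A}
    (hg : CongrOne X.ideal g.1) (hp : ∀ u, defect g u u ∈ X.param)
    (hh : ∀ u v, defect g u v + F.lam * star (defect g v u) = 0) : g ∈ relGU n X := by
  refine ⟨⟨fun u v => ?_, fun u => ?_⟩, hg, hp⟩
  · have h := hh u v
    rw [F.herm_eq, F.herm_eq, ← sub_eq_zero, ← h]
    simp only [defect, star_sub, mul_sub]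
    abel
  · rw [FormRing.quad, FormRing.quad, eq_comm, QuotientAddGroup.eq, neg_add_eq_sub]
    exact (X.le_max (hp u)).2

/-- Writing the defect as `x(u,v) - λ` times the conjugate of `x(v,u)` settles two things at once:
the contribution to `h` cancels, and the diagonal values lie in `Γ_min(I)`. When `i` and `j` have
equal signs, `f` itself is preserved and `x = 0`. -/
theorem defect_shortT (F : FormRing A) (I : Ideal A) [I.IsTwoSided] (i j : Idx n) (hij : i ≠ j)
    (hij' : i ≠ opp j) (ξ : A) (hξ : ξ ∈ I) (hξ' : star ξ ∈ I) :
    ∃ x : (Idx n → A) → (Idx n → A) → A, (∀ u v, x u v ∈ I) ∧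
      ∀ u v, defect (F.shortT i j hij hij' ξ) u v = x u v - F.lam * star (x v u) := by
  rcases i with i | i <;> rcases j with j | j
  · refine ⟨0, fun _ _ => I.zero_mem, fun u v => ?_⟩
    rw [defect_of_val_eq (F.shortT_val ..)]
    have hij : i ≠ j := fun h => hij (by rw [h])
    simp [opp, sub_eq_add_neg, Matrix.add_mulVec, Matrix.neg_mulVec, single_mulVec_eq,
      sesq_add_left, sesq_add_right, sesq_neg_left, sesq_neg_right, mul_assoc, hij]
  · refine ⟨fun u v => star (u (.inr j)) * star ξ * v (.inr i),
      fun u v => I.mul_mem_right _ (I.mul_mem_left _ hξ'), fun u v => ?_⟩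
    rw [defect_of_val_eq (F.shortT_val ..)]
    simp [opp, sub_eq_add_neg, Matrix.add_mulVec, Matrix.neg_mulVec, single_mulVec_eq,
      sesq_add_left, sesq_add_right, sesq_neg_left, sesq_neg_right, mul_assoc, F.lam_comm]
  · refine ⟨fun u v => star (u (.inl i)) * ξ * v (.inl j),
      fun u v => I.mul_mem_right _ (I.mul_mem_left _ hξ), fun u v => ?_⟩
    rw [defect_of_val_eq (F.shortT_val ..)]
    simp [opp, sub_eq_add_neg, Matrix.add_mulVec, Matrix.neg_mulVec, single_mulVec_eq,
      sesq_add_left, sesq_add_right, sesq_neg_left, sesq_neg_right, mul_assoc, F.lam_comm]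
  · refine ⟨0, fun _ _ => I.zero_mem, fun u v => ?_⟩
    rw [defect_of_val_eq (F.shortT_val ..)]
    have hij : i ≠ j := fun h => hij (by rw [h])
    simp [opp, sub_eq_add_neg, Matrix.add_mulVec, Matrix.neg_mulVec, single_mulVec_eq,
      sesq_add_left, sesq_add_right, sesq_neg_left, sesq_neg_right, mul_assoc, hij]

theorem shortT_mem_relGU (X : FormIdeal F) (i j : Idx n) (hij : i ≠ j) (hij' : i ≠ opp j) (ξ : A)
    (hξ : ξ ∈ X.ideal) : F.shortT i j hij hij' ξ ∈ relGU n X := by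
  have hξ' := X.star_mem ξ hξ
  obtain ⟨x, hx, hd⟩ := defect_shortT F X.ideal i j hij hij' ξ hξ hξ'
  refine mem_relGU_of_defect X (fun k l => ?_) (fun u => ?_) fun u v => ?_
  · rw [F.shortT_val, add_sub_cancel_left, Matrix.sub_apply, Matrix.single_apply,
      Matrix.single_apply]
    refine sub_mem ?_ ?_ <;> split_ifs
    · exact hξ
    · exact zero_mem _
    · exact Ideal.mul_mem_left _ _ hξ'
    · exact zero_mem _
  · rw [hd]
    exact X.min_le (AddSubgroup.mem_sup_left (AddSubgroup.subset_closure ⟨_, hx u u, rfl⟩))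
  · have : F.lam * (x u v * star F.lam) = x u v := by
      rw [← mul_assoc, F.lam_comm, mul_assoc, F.lam_mul_star, mul_one]
    rw [hd, hd, star_sub, star_mul, star_star, mul_sub, this]
    abel

theorem longT_mem_relGU (X : FormIdeal F) (i : Idx n) (γ : A) (hγ : γ ∈ X.param) :
    longT i (F.longCoeff i * γ) ∈ relGU n X := by
  have hmax := F.le_max γ (X.le_max hγ).2
  obtain ⟨j, s, hs, hd⟩ : ∃ (j : Idx n) (s : A), (s = γ ∨ s = -γ) ∧
      ∀ u v : Idx n → A, defect (longT i (F.longCoeff i * γ)) u v = star (u j) * s * v j := by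
    rcases i with i | i
    -- For positive `i` the coefficient arises as `γ̄ λ`, which equals `-γ`.
    · refine ⟨.inr i, -γ, Or.inr rfl, fun u v => ?_⟩
      rw [defect_of_val_eq (longT_val ..)]
      conv_rhs => rw [hmax]
      simp [opp, single_mulVec_eq, mul_assoc, F.lam_comm]
    · refine ⟨.inl i, γ, Or.inl rfl, fun u v => ?_⟩
      rw [defect_of_val_eq (longT_val ..)]
      simp [opp, single_mulVec_eq, mul_assoc]
  have hsX : s ∈ X.param := by
    rcases hs with rfl | rfl
    · exact hγ
    · exact neg_mem hγ
  refine mem_relGU_of_defect X (fun k l => ?_) (fun u => ?_) fun u v => ?_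
  · rw [longT_val, add_sub_cancel_left, Matrix.single_apply]
    split_ifs
    · exact Ideal.mul_mem_left _ _ (X.le_max hγ).1
    · exact zero_mem _
  · rw [hd]
    simpa using X.conj_mem (star (u j)) s hsX
  · have h := F.le_max s (X.le_max hsX).2
    have h' : F.lam * star s = -s := (neg_eq_iff_eq_neg.2 h).symm
    rw [hd, hd]
    simp only [star_mul, star_star, mul_assoc]
    rw [← mul_assoc F.lam, F.lam_comm, mul_assoc, ← mul_assoc F.lam, h']
    simp

theorem FU_le_relGU (X : FormIdeal F) : FU n X ≤ relGU n X := by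
  refine (Subgroup.closure_le _).2 ?_
  rintro _ (⟨i, j, hij, hij', ξ, hξ⟩ | ⟨i, γ, hγ⟩)
  · exact shortT_mem_relGU X i j hij hij' ξ hξ
  · exact longT_mem_relGU X i γ hγ

theorem absEU_le_GU : F.absEU n ≤ F.GU n := fun _ hg => (FU_le_relGU _ hg).1

theorem relGU_le_CU (X : FormIdeal F) : relGU n X ≤ CU n X := by
  refine fun g hg => ⟨hg.1, fun x hx => ?_⟩
  have h : ⁅g, x⁆ = g * (x * g⁻¹ * x⁻¹) := by simp only [commutatorElement_def]; group
  rw [h]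
  exact mul_mem hg (relGU_conj_mem X x _ hx (inv_mem hg))

/-- Since `g` preserves `h`, the two cross terms are exchanged by `z ↦ -λ z̄`. -/
theorem defect_add_eq {g : Matrix.GeneralLinearGroup (Idx n) A} (hg : g ∈ F.GU n)
    (v w : Idx n → A) : defect g (v + w) (v + w) =
      defect g v v + defect g w w + (defect g v w - F.lam * star (defect g v w)) := by
  have h : defect g w v = -(F.lam * star (defect g v w)) := by
    have := hg.1 w v
    rw [F.herm_eq, F.herm_eq] at this
    rw [defect, defect, star_sub, mul_sub, neg_sub, sub_eq_sub_iff_add_eq_add, this, add_comm]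
  rw [sub_eq_add_neg (defect g v w), ← h]
  simp only [defect, Matrix.mulVec_add, sesq_add_left, sesq_add_right]
  abel

theorem mulVec_eq_add (g : Matrix.GeneralLinearGroup (Idx n) A) (v : Idx n → A) :
    g.1 *ᵥ v = v + (g.1 - 1) *ᵥ v := by
  rw [Matrix.sub_mulVec, Matrix.one_mulVec]; abel

theorem sub_one_mulVec_mem {I : Ideal A} [I.IsTwoSided]
    {g : Matrix.GeneralLinearGroup (Idx n) A} (hg : CongrOne I g.1) (v : Idx n → A) (i : Idx n) :
    ((g.1 - 1) *ᵥ v) i ∈ I := by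
  rw [Matrix.mulVec, dotProduct]
  exact Ideal.sum_mem _ fun k _ => Ideal.mul_mem_right _ _ (hg i k)

theorem mulVec_mem_mul {I J : Ideal A} {M : Matrix (Idx n) (Idx n) A} (hM : ∀ i j, M i j ∈ I)
    {w : Idx n → A} (hw : ∀ i, w i ∈ J) (i : Idx n) : (M *ᵥ w) i ∈ I * J := by
  rw [Matrix.mulVec, dotProduct]
  exact Ideal.sum_mem _ fun k _ => Ideal.mul_mem_mul (hM i k) (hw k)

variable (X Y : FormIdeal F)

theorem sesq_mem_mul {u v : Idx n → A} (hu : ∀ i, u i ∈ X.ideal) (hv : ∀ i, v i ∈ Y.ideal) :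
    sesq u v ∈ X.ideal * Y.ideal :=
  Ideal.sum_mem _ fun _ _ => Ideal.mul_mem_mul (X.star_mem _ (hu _)) (hv _)

theorem defect_mem_mul {g : Matrix.GeneralLinearGroup (Idx n) A} (hg : CongrOne X.ideal g.1)
    (v w : Idx n → A) (hw : ∀ i, w i ∈ Y.ideal) : defect g v w ∈ X.ideal * Y.ideal := by
  have h : defect g v w = sesq ((g.1 - 1) *ᵥ v) (g.1 *ᵥ w) + sesq v ((g.1 - 1) *ᵥ w) := by
    rw [defect, mulVec_eq_add g v, sesq_add_left, mulVec_eq_add g w, sesq_add_right v]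
    abel
  rw [h]
  exact add_mem (sesq_mem_mul X Y (sub_one_mulVec_mem hg v) (mulVec_mem _ _ _ hw))
    (sesq_mem _ _ _ (mulVec_mem_mul hg hw))

variable {X Y} {S : FormIdeal F}

theorem sub_lam_star_mem_param {x : A} (hx : x ∈ S.ideal) : x - F.lam * star x ∈ S.param :=
  S.min_le (AddSubgroup.mem_sup_left (AddSubgroup.subset_closure ⟨x, hx, rfl⟩))

/-- Decompose `w` into its coordinates. A single coordinate contributes a `Y.ideal`-conjugate of an
element of `X.param`; cross terms have the form `z - λ z̄` with `z` in the product ideal. Keeping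
`S` arbitrary lets the lemma be applied with `X` and `Y` interchanged. -/
theorem defect_self_mem_param (hS : X.ideal * Y.ideal ≤ S.ideal)
    (hS' : conjParam Y.ideal X.param ≤ S.param) {g : Matrix.GeneralLinearGroup (Idx n) A}
    (hg : g ∈ relGU n X) (w : Idx n → A) (hw : ∀ i, w i ∈ Y.ideal) : defect g w w ∈ S.param := by
  have key : ∀ s : Finset (Idx n), defect g (∑ k ∈ s, Pi.single k (w k))
      (∑ k ∈ s, Pi.single k (w k)) ∈ S.param := by
    intro s
    induction s using Finset.induction_on with
    | empty => simp [defect, sesq_zero]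
    | insert a s ha ih =>
      rw [Finset.sum_insert ha, defect_add_eq hg.1]
      refine add_mem (add_mem ?_ ih) (sub_lam_star_mem_param (hS ?_))
      · have h : (Pi.single a (w a) : Idx n → A) =
            fun i => (Pi.single a (1 : A) : Idx n → A) i * w a := by
          ext i
          by_cases h : i = a
          · subst h; simp
          · simp [h]
        have h1 : g.1 *ᵥ (fun i => (Pi.single a (1 : A) : Idx n → A) i * w a) =
            fun i => (g.1 *ᵥ Pi.single a (1 : A)) i * w a := by
          ext i
          simp only [Matrix.mulVec, dotProduct, Finset.sum_mul, mul_assoc]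
        rw [h, defect, h1, sesq_mul, sesq_mul, ← sub_mul, ← mul_sub]
        exact hS' (AddSubgroup.subset_closure
          ⟨star (w a), Y.star_mem _ (hw a), _, hg.2.2 _, by rw [star_star]⟩)
      · refine defect_mem_mul X Y hg.2.1 _ _ fun i => ?_
        rw [Finset.sum_apply]
        refine Ideal.sum_mem _ fun k _ => ?_
        by_cases h : i = k
        · subst h; simpa using hw i
        · simp [h]
  have := key Finset.univ
  rwa [Finset.univ_sum_single] at this

theorem defect_mulVec_sub_mem_param (hS : X.ideal * Y.ideal ≤ S.ideal)
    (hS' : conjParam Y.ideal X.param ≤ S.param) {g h : Matrix.GeneralLinearGroup (Idx n) A}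
    (hg : g ∈ relGU n X) (hh : CongrOne Y.ideal h.1) (v : Idx n → A) :
    defect g (h.1 *ᵥ v) (h.1 *ᵥ v) - defect g v v ∈ S.param := by
  have hw := sub_one_mulVec_mem hh v
  rw [mulVec_eq_add h v, defect_add_eq hg.1, add_assoc, add_sub_cancel_left]
  exact add_mem (defect_self_mem_param hS hS' hg _ hw)
    (sub_lam_star_mem_param (hS (defect_mem_mul X Y hg.2.1 _ _ hw)))

theorem commutator_relGU_le (X Y : FormIdeal F) :
    ⁅relGU n X, relGU n Y⁆ ≤ relGU n (X.symProd Y) := by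
  rw [Subgroup.commutator_le]
  intro g hg h hh
  refine ⟨?_, fun i j => ?_, fun u => ?_⟩
  · exact mul_mem (mul_mem (mul_mem hg.1 hh.1) (inv_mem hg.1)) (inv_mem hh.1)
  -- The identity is `[g,h] - 1 = ((g-1)(h-1) - (h-1)(g-1)) (hg)⁻¹`.
  · have he : (⁅g, h⁆ : Matrix.GeneralLinearGroup (Idx n) A).1 - 1 =
        1 * ((g.1 - 1) * (h.1 - 1) - (h.1 - 1) * (g.1 - 1)) * (h * g)⁻¹.1 := by
      have h1 : ⁅g, h⁆ = g * h * (h * g)⁻¹ := by simp only [commutatorElement_def]; group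
      have h2 : (g.1 - 1) * (h.1 - 1) - (h.1 - 1) * (g.1 - 1) = (g * h).1 - (h * g).1 := by
        rw [Units.val_mul, Units.val_mul]; noncomm_ring
      rw [h1, h2, one_mul, sub_mul, Units.mul_inv, Units.val_mul _ (h * g)⁻¹]
    rw [he]
    refine mul_entries_mem _ _ _ _ (fun k l => ?_) i j
    rw [Matrix.sub_apply]
    exact sub_mem
      (Ideal.mem_sup_left (mulVec_mem_mul hg.2.1 (w := fun k => (h.1 - 1) k l)
        (fun k => hh.2.1 k l) k))
      (Ideal.mem_sup_right (mulVec_mem_mul hh.2.1 (w := fun k => (g.1 - 1) k l)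
        (fun k => hg.2.1 k l) k))
  -- With `u = hgv`, the change of `f` under `[g,h]` is the variation of the defect of `g` from `v`
  -- to `hv`, minus that of the defect of `h` from `v` to `gv`.
  · obtain ⟨v, rfl⟩ : ∃ v, u = h.1 *ᵥ (g.1 *ᵥ v) :=
      ⟨(h * g)⁻¹.1 *ᵥ u, by
        rw [Matrix.mulVec_mulVec, Matrix.mulVec_mulVec, ← Units.val_mul,
          Units.mul_inv, Matrix.one_mulVec]⟩
    have h1 : (⁅g, h⁆ : Matrix.GeneralLinearGroup (Idx n) A).1 *ᵥ (h.1 *ᵥ (g.1 *ᵥ v)) =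
        g.1 *ᵥ (h.1 *ᵥ v) := by
      simp only [Matrix.mulVec_mulVec, ← Units.val_mul]
      congr 2
      simp only [commutatorElement_def]; group
    have h2 := sub_mem
      (defect_mulVec_sub_mem_param (S := X.symProd Y) le_sup_left
        (le_sup_left.trans le_sup_left) hg hh.2.1 v)
      (defect_mulVec_sub_mem_param (S := X.symProd Y) le_sup_right
        (le_sup_right.trans le_sup_left) hh hg.2.1 v)
    rw [h1]
    convert h2 using 1
    simp only [defect]
    abel

theorem EU_le_relGU (X : FormIdeal F) : EU n X ≤ relGU n X :=
  EU_le (FU_le_relGU X) fun g hg x hx => relGU_conj_mem X g x (absEU_le_GU hg) hx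

theorem commutator_EU_le_CU (X Y : FormIdeal F) : ⁅EU n X, EU n Y⁆ ≤ CU n (X.symProd Y) :=
  ((Subgroup.commutator_mono (EU_le_relGU X) (EU_le_relGU Y)).trans
    (commutator_relGU_le X Y)).trans (relGU_le_CU _)

end Defect

end BakUnitary

/-! ### Generators obtained as commutators, and generation by comaximal levels. -/

namespace BakUnitary

section Products

variable {A : Type*} [Ring A] [StarRing A] {F : FormRing A} {n : ℕ}

theorem exists_ne_opp (hn : 3 ≤ n) (i j : Idx n) :
    ∃ k : Idx n, (i ≠ k ∧ i ≠ opp k) ∧ (k ≠ j ∧ k ≠ opp j) := by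
  obtain ⟨a, -, ha⟩ := Finset.exists_mem_notMem_of_card_lt_card
    (s := ({i.elim id id, j.elim id id} : Finset (Fin n))) (t := Finset.univ)
    (by rw [Finset.card_univ, Fintype.card_fin]; exact Finset.card_le_two.trans_lt hn)
  refine ⟨.inl a, ?_⟩
  rcases i with i | i <;> rcases j with j | j <;> simp_all [opp, eq_comm]

/-- The parameters `ξ` with `T_{ij}(ξ) ∈ K`. -/
def shortParams (F : FormRing A) (K : Subgroup (Matrix.GeneralLinearGroup (Idx n) A)) (i j : Idx n)
    (hij : i ≠ j) (hij' : i ≠ opp j) : AddSubgroup A where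
  carrier := {ξ | F.shortT i j hij hij' ξ ∈ K}
  zero_mem' := by simp [F.shortT_zero]
  add_mem' h h' := by simpa only [Set.mem_ofPred_eq, F.shortT_add] using mul_mem h h'
  neg_mem' h := by simpa only [Set.mem_ofPred_eq, F.shortT_neg] using inv_mem h

/-- The parameters `γ` with `T_{i,-i}(λ^{-(ε(i)+1)/2} γ) ∈ K` for all `i`. -/
def longParams (F : FormRing A) (K : Subgroup (Matrix.GeneralLinearGroup (Idx n) A)) :
    AddSubgroup A where
  carrier := {γ | ∀ i, longT i (F.longCoeff i * γ) ∈ K}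
  zero_mem' i := by simp [longT_zero]
  add_mem' h h' i := by simpa only [mul_add, longT_add] using mul_mem (h i) (h' i)
  neg_mem' h i := by simpa only [mul_neg, longT_neg] using inv_mem (h i)

theorem shortT_mem_FU {X : FormIdeal F} {i j : Idx n} (hij : i ≠ j) (hij' : i ≠ opp j) {ξ : A}
    (hξ : ξ ∈ X.ideal) : F.shortT i j hij hij' ξ ∈ FU n X :=
  Subgroup.subset_closure (.short i j hij hij' ξ hξ)

theorem longT_mem_FU {X : FormIdeal F} (i : Idx n) {γ : A} (hγ : γ ∈ X.param) :
    longT i (F.longCoeff i * γ) ∈ FU n X :=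
  Subgroup.subset_closure (.long i γ hγ)

theorem FU_le_iff {X : FormIdeal F} {K : Subgroup (Matrix.GeneralLinearGroup (Idx n) A)} :
    FU n X ≤ K ↔ (∀ i j hij hij', ∀ ξ ∈ X.ideal, ξ ∈ shortParams F K i j hij hij') ∧
      X.param ≤ longParams F K := by
  refine ⟨fun h => ⟨fun i j hij hij' ξ hξ => h (shortT_mem_FU hij hij' hξ),
    fun γ hγ i => h (longT_mem_FU i hγ)⟩, fun h => (Subgroup.closure_le _).2 ?_⟩
  rintro _ (⟨i, j, hij, hij', ξ, hξ⟩ | ⟨i, γ, hγ⟩)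
  · exact h.1 i j hij hij' ξ hξ
  · exact h.2 hγ i

/-- Because `α = -λ ᾱ`, the cross terms are `z` and `-λ z̄` with `z = x α ȳ`; so `x ↦ x α x̄` is
additive up to elements of `Γ_min` type. -/
theorem FormRing.conj_add (F : FormRing A) (x y : A) {α : A} (hα : α ∈ F.param) :
    (x + y) * α * star (x + y) = x * α * star x + y * α * star y +
      (x * α * star y - F.lam * star (x * α * star y)) := by
  have h : F.lam * star (x * α * star y) = -(y * α * star x) := by
    conv_rhs => rw [F.le_max α hα]
    simp only [star_mul, star_star, ← mul_assoc, F.lam_comm y, mul_neg, neg_mul, neg_neg]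
  rw [h, star_add, add_mul, add_mul, mul_add, mul_add]
  abel

variable {X Y : FormIdeal F} {K : Subgroup (Matrix.GeneralLinearGroup (Idx n) A)}

theorem mul_mem_shortParams (hn : 3 ≤ n) (hK : ⁅FU n X, FU n Y⁆ ≤ K) {i j : Idx n} (hij : i ≠ j)
    (hij' : i ≠ opp j) {z : A} (hz : z ∈ X.ideal * Y.ideal) :
    z ∈ shortParams F K i j hij hij' := by
  induction hz using Submodule.mul_induction_on' with
  | mem_mul_mem a ha b hb =>
    obtain ⟨k, ⟨hik, hik'⟩, hkj, hkj'⟩ := exists_ne_opp hn i j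
    change F.shortT i j hij hij' (a * b) ∈ K
    rw [← F.commutator_shortT_shortT i k j hik hik' hkj hkj']
    exact hK (Subgroup.commutator_mem_commutator (shortT_mem_FU _ _ ha) (shortT_mem_FU _ _ hb))
  | add a _ b _ ha hb => exact add_mem ha hb

theorem sub_lam_star_mem_longParams (hn : 3 ≤ n) (hK : ⁅FU n X, FU n Y⁆ ≤ K) {z : A}
    (hz : z ∈ X.ideal * Y.ideal) : z - F.lam * star z ∈ longParams F K := by
  induction hz using Submodule.mul_induction_on' with
  | mem_mul_mem a ha b hb =>
    intro i
    obtain ⟨j, ⟨hij, hij'⟩, hji', hji⟩ := exists_ne_opp hn i (opp i)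
    have h1 := hK (Subgroup.commutator_mem_commutator (shortT_mem_FU hij hij' ha)
      (shortT_mem_FU hji' hji hb))
    -- For positive `i` the long parameter carries a factor `λ̄`. It is reached by the inverse of
    -- the commutator built from `b̄` and `ā`, since `λ̄(ab - λ b̄ ā) = -(b̄ ā - λ̄ ab)`.
    have h2 := (Subgroup.commutator_comm (FU n X) (FU n Y) ▸ hK)
      (Subgroup.commutator_mem_commutator (shortT_mem_FU hij hij' (Y.star_mem b hb))
        (shortT_mem_FU hji' hji (X.star_mem a ha)))
    rw [F.commutator_shortT_shortT_opp] at h1 h2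
    rcases i with i | i
    · convert inv_mem h2 using 1
      rw [← longT_neg]
      congr 1
      simp [opp, mul_sub, ← mul_assoc, F.star_mul_lam]
    · simpa [opp] using h1
  | add a _ b _ ha hb =>
    have : a + b - F.lam * star (a + b) = a - F.lam * star a + (b - F.lam * star b) := by
      rw [star_add, mul_add]; abel
    rw [this]
    exact add_mem ha hb

/-- The commutator of a short and a long transvection is a short factor times the desired long one;
the short factor has parameter in the product ideal and can be cancelled. -/
theorem conj_mem_longParams (hn : 3 ≤ n) (hK : ⁅FU n X, FU n Y⁆ ≤ K) {ξ γ : A}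
    (hξ : ξ ∈ X.ideal) (hγ : γ ∈ Y.param) : ξ * γ * star ξ ∈ longParams F K := by
  intro i
  obtain ⟨j, ⟨hij, hij'⟩, -, -⟩ := exists_ne_opp hn i i
  have h1 := hK (Subgroup.commutator_mem_commutator (shortT_mem_FU hij hij' hξ)
    (longT_mem_FU j hγ))
  rw [F.commutator_shortT_longT i j hij hij' (by rwa [opp_opp]) ξ (Y.le_max hγ).2] at h1
  refine (Subgroup.mul_mem_cancel_left _ ?_).1 h1
  exact mul_mem_shortParams hn hK _ _
    (Ideal.mul_mem_mul hξ (Ideal.mul_mem_left _ _ (Y.le_max hγ).1))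

theorem conjParam_le_longParams (hn : 3 ≤ n) (hK : ⁅FU n X, FU n Y⁆ ≤ K) :
    conjParam X.ideal Y.param ≤ longParams F K := by
  refine (AddSubgroup.closure_le _).2 ?_
  rintro _ ⟨ξ, hξ, γ, hγ, rfl⟩
  exact conj_mem_longParams hn hK hξ hγ

/-- For `ξ = ab` the element is `a (b α b̄) ā` with `b α b̄ ∈ Γ_min(J) ⊆ Δ`; sums are handled by
`FormRing.conj_add`. -/
theorem mul_conj_mem_longParams (hn : 3 ≤ n) (hK : ⁅FU n X, FU n Y⁆ ≤ K) {ξ α : A}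
    (hξ : ξ ∈ X.ideal * Y.ideal) (hα : α ∈ F.param) : ξ * α * star ξ ∈ longParams F K := by
  induction hξ using Submodule.mul_induction_on' with
  | mem_mul_mem a ha b hb =>
    have : a * b * α * star (a * b) = a * (b * α * star b) * star a := by
      simp only [star_mul, mul_assoc]
    rw [this]
    exact conj_mem_longParams hn hK ha (Y.min_le (AddSubgroup.mem_sup_right
      (AddSubgroup.subset_closure ⟨b, hb, α, hα, rfl⟩)))
  | add a ha' b _ ha hb =>
    rw [F.conj_add _ _ hα]
    exact add_mem (add_mem ha hb) (sub_lam_star_mem_longParams hn hK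
      (Ideal.mul_mem_right _ _ (Ideal.mul_mem_right _ _ ha')))

theorem FU_symProd_le (hn : 3 ≤ n) (hK : ⁅FU n X, FU n Y⁆ ≤ K) : FU n (X.symProd Y) ≤ K := by
  have hK' : ⁅FU n Y, FU n X⁆ ≤ K := Subgroup.commutator_comm (FU n X) (FU n Y) ▸ hK
  refine FU_le_iff.2 ⟨fun i j hij hij' ξ hξ => ?_, sup_le (sup_le (conjParam_le_longParams hn hK')
    (conjParam_le_longParams hn hK)) (sup_le ?_ ?_)⟩
  · obtain ⟨a, ha, b, hb, rfl⟩ := Submodule.mem_sup.1 hξ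
    exact add_mem (mul_mem_shortParams hn hK _ _ ha) (mul_mem_shortParams hn hK' _ _ hb)
  · refine (AddSubgroup.closure_le _).2 ?_
    rintro _ ⟨ξ, hξ, rfl⟩
    obtain ⟨a, ha, b, hb, rfl⟩ := Submodule.mem_sup.1 hξ
    have : a + b - F.lam * star (a + b) = a - F.lam * star a + (b - F.lam * star b) := by
      rw [star_add, mul_add]; abel
    rw [this]
    exact add_mem (sub_lam_star_mem_longParams hn hK ha) (sub_lam_star_mem_longParams hn hK' hb)
  · refine (AddSubgroup.closure_le _).2 ?_
    rintro _ ⟨ξ, hξ, α, hα, rfl⟩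
    obtain ⟨a, ha, b, hb, rfl⟩ := Submodule.mem_sup.1 hξ
    rw [SetLike.mem_coe, F.conj_add _ _ hα]
    exact add_mem (add_mem (mul_conj_mem_longParams hn hK ha hα)
      (mul_conj_mem_longParams hn hK' hb hα)) (sub_lam_star_mem_longParams hn hK
      (Ideal.mul_mem_right _ _ (Ideal.mul_mem_right _ _ ha)))

theorem EU_symProd_le (hn : 3 ≤ n) (X Y : FormIdeal F) :
    EU n (X.symProd Y) ≤ ⁅EU n X, EU n Y⁆ :=
  EU_le (FU_symProd_le hn (Subgroup.commutator_mono (FU_le_EU X) (FU_le_EU Y)))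
    fun g hg => Subgroup.commutator_conj_mem _ _ g (EU_conj_mem X g hg) (EU_conj_mem Y g hg)

/-- The symmetrised product of the unit form ideal with `X` contains `X`, as multiplying and
conjugating by `1` shows. -/
theorem EU_le_commutator_absEU (hn : 3 ≤ n) (X : FormIdeal F) : EU n X ≤ ⁅F.absEU n, EU n X⁆ := by
  rw [← EU_unit]
  refine (EU_mono ?_ ?_).trans (EU_symProd_le hn (FormIdeal.unit F) X)
  · exact fun x hx => Ideal.mem_sup_left
      (one_mul x ▸ Ideal.mul_mem_mul (Submodule.mem_top : (1 : A) ∈ ⊤) hx)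
  · exact fun x hx => AddSubgroup.mem_sup_left (AddSubgroup.mem_sup_right
      (AddSubgroup.subset_closure ⟨1, Submodule.mem_top, x, hx, by simp⟩))

theorem EU_sup_EU (X Y : FormIdeal F) (hXY : X.ideal ⊔ Y.ideal = ⊤) :
    EU n X ⊔ EU n Y = F.absEU n := by
  refine le_antisymm (sup_le (EU_le_absEU X) (EU_le_absEU Y)) ?_
  have hX := FU_le_iff.1 ((FU_le_EU X).trans (le_sup_left : EU n X ≤ EU n X ⊔ EU n Y))
  have hY := FU_le_iff.1 ((FU_le_EU Y).trans (le_sup_right : EU n Y ≤ EU n X ⊔ EU n Y))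
  refine FU_le_iff.2 ⟨fun i j hij hij' ξ _ => ?_, fun α hα => ?_⟩
  · obtain ⟨x, hx, y, hy, rfl⟩ := Submodule.mem_sup.1 (hXY ▸ Submodule.mem_top : ξ ∈ _)
    exact add_mem (hX.1 i j hij hij' x hx) (hY.1 i j hij hij' y hy)
  -- Long parameters are not split additively but by expanding `α = (x + y) α (x + y)̄` with `x + y
  -- = 1`.
  · obtain ⟨x, hx, y, hy, h⟩ := Submodule.mem_sup.1 (hXY ▸ Submodule.mem_top : (1 : A) ∈ _)
    have h1 := F.conj_add x y hα
    rw [h, star_one, one_mul, mul_one] at h1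
    rw [h1]
    exact add_mem (add_mem
      (hX.2 (X.min_le (AddSubgroup.mem_sup_right (AddSubgroup.subset_closure ⟨x, hx, α, hα, rfl⟩))))
      (hY.2 (Y.min_le (AddSubgroup.mem_sup_right (AddSubgroup.subset_closure ⟨y, hy, α, hα, rfl⟩)))))
      (hX.2 (sub_lam_star_mem_param
        (Ideal.mul_mem_right _ _ (Ideal.mul_mem_right _ _ hx))))

end Products

end BakUnitary

theorem theorem3 {A : Type*} [Ring A] [StarRing A] (F : BakUnitary.FormRing A)
    (n : ℕ) (hn : 3 ≤ n) (hF : F.AbsoluteStandardCommutatorFormulae n)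
    (X Y : BakUnitary.FormIdeal F) (hXY : X.ideal ⊔ Y.ideal = ⊤) :
    ⁅BakUnitary.EU n X, BakUnitary.EU n Y⁆ = BakUnitary.EU n (X.symProd Y) := by
  refine le_antisymm (Subgroup.commutator_le_of_sup_eq (F.absEU n) _ _ _
    (BakUnitary.EU_sup_EU X Y hXY) (BakUnitary.EU_le_absEU _) (BakUnitary.EU_conj_mem X)
    (BakUnitary.EU_conj_mem Y) (BakUnitary.EU_conj_mem _) (BakUnitary.EU_le_commutator_absEU hn X)
    ?_) (BakUnitary.EU_symProd_le hn X Y)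
  -- Centrality modulo the target: replace the target by `⁅absEU, CU⁆` and compare second arguments.
  rw [(hF (X.symProd Y)).2]
  exact Subgroup.commutator_mono le_rfl (BakUnitary.commutator_EU_le_CU X Y)
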